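/- Let $p$ be a prime. Let $q=p^m$ for some integer $m\ge 0$, and let $s=(s(n))_{n\ge 0}$ be a sequence of $p$-adic integers. A \emph{twisted interpolation} of $s$ to $\mathbb{Z}_p$ is a finite family $\{(s_j,A_j): j\in J\}$ such that the sets $A_j$ form a partition of $\mathbb{N}=\{0,1,2,\dots\}$; each $A_j$ is a dense subset of $r+q\mathbb{Z}_p$ for some integer $0\le r\le q-1$ (depending on $j$); each $s_j:\mathbb{Z}_p\to K$ is a continuous function, where $K$ is a finite extension of $\mathbb{Q}_p$ (the same for all $j$) with the absolute value extending $|\cdot|_p$; and $s(n)=s_j(n)$ for all $j\in J$ and all $n\in A_j$. Here the power $q$ of $p$ and the extension $K$ may be chosen freely. Corollary 3.5. Let $p$ be a prime, and let $s(n)_{n\ge 0}$ be a sequence of $p$-adic integers satisfying $$s(n+\ell)+a_{\ell-1}s(n+\ell-1)+\dots+a_1s(n+1)+a_0s(n)=0\qquad\text{for all } n\ge 0,$$ that is, a constant-recursive sequence with monic characteristic polynomial $x^\ell+a_{\ell-1}x^{\ell-1}+\dots+a_1x+a_0\in\mathbb{Z}_p[x]$. If $|a_0|_p=1$, then there exists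 a twisted interpolation of $s(n)_{n\ge 0}$ to $\mathbb{Z}_p$. -/

import Mathlib

/-- The family `(f j, A j)`, `j ∈ J`, is a twisted interpolation to `ℤ_p` of the sequence `s` of
`p`-adic integers, with respect to the power `q` of `p` and the finite extension `K` of `ℚ_p`.

A `NormedField` structure on `K` together with `NormedAlgebra ℚ_[p] K` is the same as an
absolute value on `K` extending the `p`-adic one; for `K` finite over `ℚ_p` there is exactly one. -/
structure IsTwistedInterpolation (p : ℕ) [Fact p.Prime] (s : ℕ → ℤ_[p]) (q : ℕ)
    (K : Type) [NormedField K] [NormedAlgebra ℚ_[p] K]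
    (J : Type) (A : J → Set ℕ) (f : J → ℤ_[p] → K) : Prop where
  /-- `q ≥ 1` is a power of `p` (possibly `p ^ 0 = 1`). -/
  isPow : ∃ m : ℕ, q = p ^ m
  /-- `K` is a finite extension of `ℚ_p`. -/
  finiteDimensional : FiniteDimensional ℚ_[p] K
  /-- The partition is finite. -/
  finite : Finite J
  /-- The sets `A j` cover `ℕ`. -/
  iUnion_eq : ⋃ j, A j = Set.univ
  /-- The sets `A j` are pairwise disjoint. -/
  disjoint : ∀ i j : J, i ≠ j → Disjoint (A i) (A j)
  /-- Each `A j` is contained in, and dense in, some residue class `r + q ℤ_p`. -/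
  dense : ∀ j : J, ∃ r : ℕ, r < q ∧
    (∀ n ∈ A j, ∃ y : ℤ_[p], (n : ℤ_[p]) = r + q * y) ∧
    ∀ y : ℤ_[p], (r + q * y : ℤ_[p]) ∈ closure ((fun n : ℕ => (n : ℤ_[p])) '' A j)
  /-- Each `f j` is continuous on `ℤ_p`. -/
  continuous : ∀ j : J, Continuous (f j)
  /-- `s(n) = f_j(n)` for all `n ∈ A j`. -/
  eq_on : ∀ j : J, ∀ n ∈ A j, algebraMap ℚ_[p] K (s n : ℚ_[p]) = f j (n : ℤ_[p])

/-- There exists a twisted interpolation of `s` to `ℤ_p`. -/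
def HasTwistedInterpolation (p : ℕ) [Fact p.Prime] (s : ℕ → ℤ_[p]) : Prop :=
  ∃ (q : ℕ) (K : Type) (_ : NormedField K) (_ : NormedAlgebra ℚ_[p] K)
    (J : Type) (A : J → Set ℕ) (f : J → ℤ_[p] → K),
    IsTwistedInterpolation p s q K J A f

/-! Let `α` be the class of `X` in `ℤ_p[X]/(χ)`, with `χ` the characteristic polynomial. As `χ(0)`
is a unit, `α` is a unit in the finite quotient mod `p`, so `α ^ N ≡ 1` mod `p` for some `N > 0`.
Raising to the power `p ^ t` makes this a congruence mod `p ^ t`, and the functional `X ^ n ↦ s n`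
transfers it to `s`. Write `N = p ^ v * d` with `p ∤ d`: on a class mod `N`, `p`-adically close
indices differ by a multiple of `N * p ^ t`, so `s` is uniformly continuous there and extends. Thus
`q = p ^ v` and `K = ℚ_p` suffice. -/

open Polynomial in
/-- The linear functional sending `X ^ n` to `s n` kills multiples of the characteristic polynomial
of a recurrence satisfied by `s`. -/
theorem LinearRecurrence.IsSolution.exists_functional {R : Type*} [CommRing R]
    {E : LinearRecurrence R} {s : ℕ → R} (hs : E.IsSolution s) :
    ∃ φ : R[X] →ₗ[R] R, (∀ n, φ (X ^ n) = s n) ∧ ∀ g, φ (E.charPoly * g) = 0 := by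
  let φ : R[X] →ₗ[R] R := (Polynomial.basisMonomials R).constr R s
  have hφ (n : ℕ) (a : R) : φ (monomial n a) = a * s n := by
    have h : φ (monomial n 1) = s n := by
      simpa using (Polynomial.basisMonomials R).constr_basis R s n
    rw [← mul_one a, ← smul_eq_mul, ← smul_monomial, map_smul, h, smul_eq_mul, smul_eq_mul, mul_one]
  refine ⟨φ, fun n ↦ by rw [X_pow_eq_monomial, hφ, one_mul], fun g ↦ ?_⟩
  induction g using Polynomial.induction_on' with
  | add f g hf hg => rw [mul_add, map_add, hf, hg, add_zero]
  | monomial n a =>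
    rw [LinearRecurrence.charPoly, sub_mul, Finset.sum_mul, map_sub, map_sum, sub_eq_zero,
      monomial_mul_monomial, hφ, add_comm, hs n, one_mul, Finset.mul_sum]
    refine Finset.sum_congr rfl fun i _ ↦ ?_
    rw [monomial_mul_monomial, hφ, add_comm n]
    ring

open Polynomial in
/-- A monic polynomial over a finite field with nonzero constant coefficient divides some
`X ^ N - 1`. -/
theorem Polynomial.Monic.exists_dvd_X_pow_sub_one {F : Type*} [Field F] [Finite F] {f : F[X]}
    (hf : f.Monic) (h0 : f.coeff 0 ≠ 0) : ∃ N, 0 < N ∧ f ∣ X ^ N - 1 := by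
  have := hf.finite_adjoinRoot
  have : Finite (AdjoinRoot f) := Module.finite_of_finite F
  have hu : IsUnit (AdjoinRoot.root f) := by
    -- From `f = f(0) + X * g`, the root times `g(root)` is the unit `-f(0)`.
    obtain ⟨g, hg⟩ : X ∣ f - C (f.coeff 0) := by simp [X_dvd_iff]
    have h : AdjoinRoot.root f * AdjoinRoot.mk f g = - AdjoinRoot.of f (f.coeff 0) := by
      have := congrArg (AdjoinRoot.mk f) hg
      rw [map_sub, AdjoinRoot.mk_self, map_mul, AdjoinRoot.mk_X, AdjoinRoot.mk_C, zero_sub] at this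
      exact this.symm
    refine isUnit_of_mul_isUnit_left (h ▸ IsUnit.neg ?_)
    exact (IsUnit.mk0 _ h0).map _
  obtain ⟨u, hu⟩ := hu
  obtain ⟨N, hN, h⟩ := isOfFinOrder_iff_pow_eq_one.1 (isOfFinOrder_of_finite u)
  refine ⟨N, hN, AdjoinRoot.mk_eq_zero.1 ?_⟩
  rw [map_sub, map_pow, AdjoinRoot.mk_X, ← hu, ← Units.val_pow_eq_pow_val, h]
  simp

open Polynomial in
theorem PadicInt.exists_natCast_dvd_root_pow_sub_one {p : ℕ} [Fact p.Prime] {f : ℤ_[p][X]}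
    (hf : f.Monic) (h0 : ‖f.coeff 0‖ = 1) :
    ∃ N, 0 < N ∧ (p : AdjoinRoot f) ∣ AdjoinRoot.root f ^ N - 1 := by
  have h0' : (f.map (PadicInt.toZMod (p := p))).coeff 0 ≠ 0 := by
    rw [coeff_map]
    exact ((PadicInt.isUnit_iff.2 h0).map _).ne_zero
  obtain ⟨N, hN, g, hg⟩ := (hf.map (PadicInt.toZMod (p := p))).exists_dvd_X_pow_sub_one h0'
  obtain ⟨g, rfl⟩ := map_surjective _ (ZMod.ringHom_surjective (PadicInt.toZMod (p := p))) g
  refine ⟨N, hN, ?_⟩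
  have h : C (p : ℤ_[p]) ∣ X ^ N - 1 - f * g := by
    rw [C_dvd_iff_dvd_coeff]
    intro i
    rw [← Ideal.mem_span_singleton, ← PadicInt.maximalIdeal_eq_span_p, ← PadicInt.ker_toZMod,
      RingHom.mem_ker, ← coeff_map]
    simp [hg]
  simpa using map_dvd (AdjoinRoot.mk f) h

/-- A solution of a linear recurrence with unit constant coefficient is periodic modulo `p ^ t`
with period `N * p ^ t`. -/
theorem LinearRecurrence.IsSolution.exists_pow_dvd_sub {p : ℕ} [Fact p.Prime]
    {E : LinearRecurrence ℤ_[p]} {s : ℕ → ℤ_[p]} (hs : E.IsSolution s)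
    (h0 : ‖E.charPoly.coeff 0‖ = 1) :
    ∃ N, 0 < N ∧ ∀ t n k, (p : ℤ_[p]) ^ t ∣ s (n + N * (p ^ t * k)) - s n := by
  obtain ⟨φ, hφ, hker⟩ := hs.exists_functional
  obtain ⟨N, hN, hdvd⟩ := PadicInt.exists_natCast_dvd_root_pow_sub_one E.charPoly_monic h0
  refine ⟨N, hN, fun t n k ↦ ?_⟩
  -- `a ≡ b` mod `p` gives `a ^ p ^ t ≡ b ^ p ^ t` mod `p ^ (t + 1)`, one power more than needed.
  have h1 := (pow_dvd_pow _ t.le_succ).trans (dvd_sub_pow_of_dvd_sub hdvd t)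
  obtain ⟨y, hy⟩ := (h1.trans (sub_dvd_pow_sub_pow _ _ k)).mul_left
    (AdjoinRoot.root E.charPoly ^ n)
  obtain ⟨g, rfl⟩ := AdjoinRoot.mk_surjective y
  obtain ⟨c, hc⟩ : E.charPoly ∣ (Polynomial.X ^ (n + N * (p ^ t * k)) - Polynomial.X ^ n) -
      Polynomial.C ((p : ℤ_[p]) ^ t) * g := by
    rw [← AdjoinRoot.mk_eq_zero, map_sub, sub_eq_zero]
    simp only [map_sub, map_pow, AdjoinRoot.mk_X, map_mul, map_natCast]
    rw [← hy]
    ring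
  refine ⟨φ g, ?_⟩
  have h2 := congrArg φ hc
  rw [hker, Polynomial.C_mul', map_sub, map_sub, map_smul, hφ, hφ, sub_eq_zero] at h2
  simpa using h2

theorem PadicInt.natCast_pow_dvd_natCast_iff {p : ℕ} [Fact p.Prime] {t k : ℕ} :
    (p : ℤ_[p]) ^ t ∣ k ↔ p ^ t ∣ k := by
  rw [← Ideal.mem_span_singleton, ← PadicInt.norm_le_pow_iff_mem_span_pow, ← Int.cast_natCast k,
    PadicInt.norm_int_le_pow_iff_dvd]
  exact_mod_cast Iff.rfl

theorem PadicInt.exists_pow_dvd_sub_of_dist_lt {p : ℕ} [Fact p.Prime] (t : ℕ) :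
    ∃ δ > 0, ∀ x y : ℤ_[p], dist x y < δ → (p : ℤ_[p]) ^ t ∣ x - y := by
  refine ⟨(p : ℝ) ^ (-t : ℤ), zpow_pos (by exact_mod_cast (Fact.out : p.Prime).pos) _,
    fun x y h ↦ ?_⟩
  rw [← Ideal.mem_span_singleton, ← PadicInt.norm_le_pow_iff_mem_span_pow, ← dist_eq_norm]
  exact h.le

/-- The arithmetic progression `j + p ^ v * d * ℕ` with `p ∤ d` is dense in `j + p ^ v * ℤ_p`. -/
theorem PadicInt.mem_closure_natCast_image_modEq {p : ℕ} [Fact p.Prime] {v d : ℕ}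
    (hd : ¬ p ∣ d) {j : ℕ} {x : ℤ_[p]} (hx : (p : ℤ_[p]) ^ v ∣ x - j) :
    x ∈ closure ((fun n : ℕ ↦ (n : ℤ_[p])) '' {n | n ≡ j [MOD p ^ v * d]}) := by
  obtain ⟨y, hy⟩ := hx
  have hu : IsUnit (d : ℤ_[p]) := by
    rw [PadicInt.isUnit_iff]
    refine le_antisymm (PadicInt.norm_le_one _) (not_lt.1 fun h ↦ hd ?_)
    exact_mod_cast (PadicInt.norm_int_lt_one_iff_dvd (p := p) (d : ℤ)).1 (by simpa using h)
  obtain ⟨u, hu⟩ := hu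
  -- Since `d` is a unit, this map sends `ℤ_p` onto `j + p ^ v * ℤ_p`, and the dense subset `ℕ` into
  -- the progression.
  let φ : ℤ_[p] → ℤ_[p] := fun z ↦ j + p ^ v * d * z
  have hφ : Continuous φ := by fun_prop
  have hxφ : φ (↑u⁻¹ * y) = x := by
    simp only [φ]
    rw [← hu, mul_assoc, Units.mul_inv_cancel_left, ← hy]
    ring
  rw [← hxφ]
  refine map_mem_closure hφ (PadicInt.denseRange_natCast _) ?_
  rintro _ ⟨k, rfl⟩
  refine ⟨j + p ^ v * d * k, ?_, by simp [φ]⟩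
  simp [Nat.ModEq]

/-- A sequence that is `N * p ^ t`-periodic modulo `p ^ t` for all `t` is, on each residue class
modulo `N = p ^ v * d`, the restriction of a continuous function on `ℤ_p`. -/
theorem PadicInt.exists_continuous_eq_on_modEq {p : ℕ} [Fact p.Prime] {v d : ℕ} (hd : ¬ p ∣ d)
    {s : ℕ → ℤ_[p]}
    (hs : ∀ t n k, (p : ℤ_[p]) ^ t ∣ s (n + p ^ v * d * (p ^ t * k)) - s n) (j : ℕ) :
    ∃ f : ℤ_[p] → ℤ_[p], Continuous f ∧ ∀ n, n ≡ j [MOD p ^ v * d] → f n = s n := by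
  classical
  have hp : p.Prime := Fact.out
  let B : Set ℕ := {n | n ≡ j [MOD p ^ v * d]}
  let T : Set ℤ_[p] := (fun n : ℕ ↦ (n : ℤ_[p])) '' B
  -- Adding the complement of the disc makes the domain dense in `ℤ_p`. The value `0` there is
  -- harmless because the disc is clopen: points congruent mod `p ^ v` lie on the same side.
  let S : Set ℤ_[p] := T ∪ {x | ¬ (p : ℤ_[p]) ^ v ∣ x - j}
  have hS : Dense S := fun x ↦ by
    by_cases hx : (p : ℤ_[p]) ^ v ∣ x - j
    · exact closure_mono Set.subset_union_left (mem_closure_natCast_image_modEq hd hx)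
    · exact subset_closure (Or.inr hx)
  let g : S → ℤ_[p] := fun x ↦ if h : (x : ℤ_[p]) ∈ T then s h.choose else 0
  have hg (n : ℕ) (hn : n ∈ B) (h : (n : ℤ_[p]) ∈ S) : g ⟨n, h⟩ = s n := by
    have hT : (n : ℤ_[p]) ∈ T := ⟨n, hn, rfl⟩
    simp only [g, dif_pos hT]
    exact congrArg s (Nat.cast_injective hT.choose_spec.2)
  have hB (n : ℕ) (hn : n ∈ B) : (p : ℤ_[p]) ^ v ∣ n - j := by
    obtain ⟨c, hc⟩ := (Nat.modEq_iff_dvd.1 (Nat.ModEq.symm hn))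
    refine ⟨d * c, ?_⟩
    have := congrArg (Int.cast : ℤ → ℤ_[p]) hc
    push_cast at this
    rw [this, mul_assoc]
  have hsB (t n m : ℕ) (hn : n ∈ B) (hm : m ∈ B) (hnm : n ≤ m)
      (h : (p : ℤ_[p]) ^ (t + v) ∣ m - n) : (p : ℤ_[p]) ^ t ∣ s m - s n := by
    obtain ⟨k, hk⟩ := (Nat.modEq_iff_dvd' hnm).1 (Nat.ModEq.trans hn (Nat.ModEq.symm hm))
    rw [← Nat.cast_sub hnm, natCast_pow_dvd_natCast_iff, hk, add_comm, pow_add, mul_assoc] at h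
    -- Cancelling `p ^ v` leaves `p ^ t ∣ d * k`, and `d` is prime to `p`.
    obtain ⟨l, rfl⟩ := (((Nat.Prime.coprime_iff_not_dvd hp).2 hd).pow_left t).dvd_of_dvd_mul_left
      (Nat.dvd_of_mul_dvd_mul_left (pow_pos hp.pos v) h)
    rw [← Nat.add_sub_cancel' hnm, hk]
    exact hs t n l
  have huc : UniformContinuous g := by
    rw [Metric.uniformContinuous_iff]
    intro ε hε
    obtain ⟨t, ht⟩ := PadicInt.exists_pow_neg_lt p hε
    obtain ⟨δ, hδ, hδ'⟩ := exists_pow_dvd_sub_of_dist_lt (p := p) (t + v)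
    refine ⟨δ, hδ, ?_⟩
    rintro ⟨x, hx⟩ ⟨y, hy⟩ hxy
    replace hxy := hδ' x y hxy
    have hv := (pow_dvd_pow (p : ℤ_[p]) (Nat.le_add_left v t)).trans hxy
    refine lt_of_le_of_lt ?_ ht
    rw [dist_eq_norm, PadicInt.norm_le_pow_iff_mem_span_pow, Ideal.mem_span_singleton]
    by_cases hxT : x ∈ T <;> by_cases hyT : y ∈ T
    · obtain ⟨n, hn, rfl⟩ := hxT
      obtain ⟨m, hm, rfl⟩ := hyT
      simp only [hg n hn, hg m hm]
      rcases le_total m n with h | h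
      · exact hsB t m n hm hn h hxy
      · exact (dvd_sub_comm).1 (hsB t n m hn hm h ((dvd_sub_comm).1 hxy))
    · obtain ⟨n, hn, rfl⟩ := hxT
      refine absurd ?_ (hy.resolve_left hyT)
      simpa using dvd_sub (hB n hn) hv
    · obtain ⟨m, hm, rfl⟩ := hyT
      refine absurd ?_ (hx.resolve_left hxT)
      simpa using dvd_add (hB m hm) hv
    · simp [g, hxT, hyT]
  refine ⟨hS.extend g, (hS.uniformContinuous_extend huc).continuous, fun n hn ↦ ?_⟩
  have hnS : (n : ℤ_[p]) ∈ S := Or.inl ⟨n, hn, rfl⟩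
  exact (hS.extend_of_ind huc ⟨n, hnS⟩).trans (hg n hn hnS)

theorem corollary3p5 (p : ℕ) [Fact p.Prime] (s : ℕ → ℤ_[p]) (E : LinearRecurrence ℤ_[p])
    (hs : E.IsSolution s) (ha : ‖E.charPoly.coeff 0‖ = 1) :
    HasTwistedInterpolation p s := by
  obtain ⟨N, hN, hper⟩ := hs.exists_pow_dvd_sub ha
  obtain ⟨v, d, hd, rfl⟩ :=
    Nat.exists_eq_pow_mul_and_not_dvd hN.ne' p (Fact.out : p.Prime).ne_one
  choose f hf hfs using PadicInt.exists_continuous_eq_on_modEq hd hper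
  have hq : 0 < p ^ v := pow_pos (Fact.out : p.Prime).pos v
  have hr (j : ℕ) : ((j : ℕ) : ℤ_[p]) = (j % p ^ v : ℕ) + p ^ v * (j / p ^ v : ℕ) := by
    exact_mod_cast (Nat.mod_add_div j (p ^ v)).symm
  refine ⟨p ^ v, ℚ_[p], inferInstance, inferInstance, Fin (p ^ v * d),
    fun j ↦ {n | n ≡ j [MOD p ^ v * d]}, fun j x ↦ f j x, ⟨v, rfl⟩, inferInstance, inferInstance,
    ?_, ?_, ?_, ?_, ?_⟩
  · refine Set.eq_univ_of_forall fun n ↦ Set.mem_iUnion.2 ⟨⟨n % (p ^ v * d), Nat.mod_lt _ hN⟩, ?_⟩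
    exact (Nat.mod_modEq _ _).symm
  · refine fun i j hij ↦ Set.disjoint_left.2 fun n hi hj ↦ hij (Fin.ext ?_)
    exact (hi.symm.trans hj).eq_of_lt_of_lt i.2 j.2
  · refine fun j ↦ ⟨j % p ^ v, Nat.mod_lt _ hq, fun n hn ↦ ⟨(n / p ^ v : ℕ), ?_⟩, fun y ↦ ?_⟩
    · have h : n % p ^ v = j % p ^ v := hn.of_mul_right d
      rw [← h]
      exact_mod_cast hr n
    · refine PadicInt.mem_closure_natCast_image_modEq hd ⟨y - (j / p ^ v : ℕ), ?_⟩
      rw [hr j]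
      push_cast
      ring
  · exact fun j ↦ continuous_subtype_val.comp (hf j)
  · intro j n hn
    simp [hfs j n hn]
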